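/- Setting. Let $g:[0,\infty)\to[0,\infty)$ be continuous and nondecreasing, and let $Y_0,Y_1,\dots$ be i.i.d. delays with $\Pr(Y_j\in[B_L,B_U])=1$, $B_L>0$. Update $0$ is delivered at time $D_0=0$ with age $Y_0$ (it was requested at $R_0=-Y_0$). After the delivery of update $j$ at time $D_j$ one waits $Z_j\in[0,M]$, requests update $j+1$ at $R_{j+1}=D_j+Z_j$, and receives it at $D_{j+1}=R_{j+1}+Y_{j+1}$. The age at time $t$ is $\Delta(t)=t-\max\{R_j: D_j\le t\}$. A causal policy chooses $Z_j$ from the past waits, the delays $Y_0,\dots,Y_j$ and a random seed independent of the delays. A deterministic (stationary) policy $\pi$ is a measurable decision function $z$ with values in $[0,M]$, through which $Z_j=z(Y_j,Q-D_j)$. The single query problem with query time $Q$ is to minimize $E[g(\Delta(Q))]$ over all causal policies. Write $G_D^\pi(s,a)$ (resp. $G_R^\pi(s,b)$) for the expected penalty at the query under $\pi$, given a delivery with age $a$ (resp. a request at which the age is $b$) when the remaining time until the query is $s$. Call a deterministic policy $\pi$ optimal at all deliveries if for all $D\in[0,Q]$ and $a\in[B_L,B_U]$, $G_D^\pi(Q-D,a)$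 is the least expected penalty that any causal policy achieves after a delivery at time $D$ with age $a$. The selected point $Q^{BP}$ of $\pi$ is the request time that $\pi$ chooses after a delivery at time $Q-3B_U$ with age $B_L$, that is, $Q^{BP}=Q-3B_U+z(B_L,3B_U)$. A time $P\in[0,Q-B_U]$ is a border point of $\pi$ if $G_R^\pi(Q-P,b)\le G_R^\pi(Q-R,b')$ for all $R\in[0,Q-B_U]$ and all $b,b'\ge0$ (in particular, the age at the request is irrelevant for such request times). A request at time $R$ is optimal after a delivery at time $D$ with age $a$ if $R-D\in[0,M]$ and $G_R^\pi(Q-R,a+R-D)$ is at most the expected penalty that any causal policy achieves after that delivery. Claim. Assume $Q>3B_U$ and $M\ge Q-B_U$. (1) There is a deterministic policy $\pi$ that is optimal for the single query problem with query time $Q$ and optimal at all deliveries, such that $Q^{BP}\in[Q-3B_U,Q-B_U]$, $Q^{BP}$ is a border point of $\pi$, the first request of $\pi$ is at time $Q^{BP}$ whatever $Y_0\in[B_L,B_U]$ is, and for every $D\in[0,Q-3B_U)$ and $a\in[B_L,B_U]$, after a delivery at time $D$ with age $a$, $\pi$ waits until $Q^{BP}$ and the request at $Q^{BP}$ is optimal.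 (2) For every deterministic policy $\pi$ that is optimal at all deliveries and has $Q^{BP}\le Q-B_U$, the point $Q^{BP}$ is a border point of $\pi$, and the request at $Q^{BP}$ is optimal after a delivery at any time $D\in[0,Q-3B_U)$ with any age $a\in[B_L,B_U]$. (3) If $g$ is strictly increasing and $\Pr(Y_j>x)>0$ for every $x<B_U$, then $Q^{BP}\in[Q-3B_U,Q-B_U]$ for every deterministic policy $\pi$ that is optimal at all deliveries. -/

import Mathlib

open MeasureTheory Set

noncomputable section

namespace PullOrWait

/-! ### Sample paths

A path is given by the delays `y j` and the waiting periods `w j`. The clock starts at the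
delivery of update `0`, whose age at that moment is `y 0`. -/

/-- Delivery time `D j`: `D 0 = 0` and `D (j + 1) = R (j + 1) + y (j + 1)`. -/
def deliveryTime (y w : ℕ → ℝ) : ℕ → ℝ
  | 0 => 0
  | j + 1 => deliveryTime y w j + w j + y (j + 1)

/-- Request time `R j`: `R 0 = D 0 - y 0` and `R (j + 1) = D j + w j`. -/
def requestTime (y w : ℕ → ℝ) : ℕ → ℝ
  | 0 => -y 0
  | j + 1 => deliveryTime y w j + w j

/-- Generation time `U(t) = max {R j : D j ≤ t}` of the most recently received update. -/
def generationTime (y w : ℕ → ℝ) (t : ℝ) : ℝ :=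
  sSup {r | ∃ j, deliveryTime y w j ≤ t ∧ r = requestTime y w j}

/-- Age of information `Δ(t) = t - U(t)`. -/
def age (y w : ℕ → ℝ) (t : ℝ) : ℝ := t - generationTime y w t

/-! ### Policies -/

/-- A causal, possibly randomized, update policy with waiting periods in `[0, M]`. The `j`-th
waiting period is a function of the delays `y 0, …, y j` observed so far and of a random seed that
is independent of the delays. The earlier waiting periods are themselves functions of the seed and
of earlier delays, so a dependence on them is included. -/
structure CausalPolicy (M : ℝ) where
  /-- values of the random seed (for instance a sequence of seeds, one for each decision) -/
  Seed : Type
  [measurableSpaceSeed : MeasurableSpace Seed]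
  /-- law of the random seed -/
  seedLaw : Measure Seed
  [isProbabilityMeasure : IsProbabilityMeasure seedLaw]
  /-- waiting period after the `j`-th delivery, given the seed and the delays -/
  wait : ℕ → Seed → (ℕ → ℝ) → ℝ
  measurable_wait : ∀ j, Measurable fun p : Seed × (ℕ → ℝ) => wait j p.1 p.2
  wait_mem : ∀ j ξ y, wait j ξ y ∈ Icc 0 M
  causal : ∀ j ξ y y', (∀ i ≤ j, y i = y' i) → wait j ξ y = wait j ξ y'

attribute [instance] CausalPolicy.measurableSpaceSeed CausalPolicy.isProbabilityMeasure

/-- A stationary deterministic policy: the waiting period is `decision Δ s`, where `Δ` is the age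
at the delivery and `s` the remaining time until the query. (Only the values at nonnegative
arguments matter.) -/
structure StationaryPolicy (M : ℝ) where
  decision : ℝ → ℝ → ℝ
  measurable_decision : Measurable fun p : ℝ × ℝ => decision p.1 p.2
  decision_mem : ∀ a s, decision a s ∈ Icc 0 M

/-- Delivery times when the query is at time `s` and the `j`-th waiting period is
`q j Δ r`, with `Δ` the age at the `j`-th delivery and `r` the time left until the query. -/
def feedbackDelivery (q : ℕ → ℝ → ℝ → ℝ) (s : ℝ) (y : ℕ → ℝ) : ℕ → ℝ
  | 0 => 0
  | j + 1 => feedbackDelivery q s y j + q j (y j) (s - feedbackDelivery q s y j) + y (j + 1)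

theorem measurable_feedbackDelivery {q : ℕ → ℝ → ℝ → ℝ}
    (hq : ∀ j, Measurable fun p : ℝ × ℝ => q j p.1 p.2) (s : ℝ) (j : ℕ) :
    Measurable fun y => feedbackDelivery q s y j := by
  induction j with
  | zero => exact measurable_const
  | succ j ih =>
    exact (ih.add ((hq j).comp ((measurable_pi_apply j).prodMk (measurable_const.sub ih)))).add
      (measurable_pi_apply (j + 1))

theorem feedbackDelivery_congr (q : ℕ → ℝ → ℝ → ℝ) (s : ℝ) {y y' : ℕ → ℝ} (j : ℕ)
    (h : ∀ i ≤ j, y i = y' i) : feedbackDelivery q s y j = feedbackDelivery q s y' j := by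
  induction j with
  | zero => rfl
  | succ j ih =>
    simp only [feedbackDelivery]
    rw [ih fun i hi => h i (by omega), h j (by omega), h (j + 1) le_rfl]

/-- The causal policy for a query at time `s` given by stage-dependent feedback rules `q j`. -/
def feedbackPolicy {M : ℝ} (q : ℕ → ℝ → ℝ → ℝ)
    (hq : ∀ j, Measurable fun p : ℝ × ℝ => q j p.1 p.2) (hM : ∀ j a r, q j a r ∈ Icc 0 M)
    (s : ℝ) : CausalPolicy M where
  Seed := Unit
  seedLaw := Measure.dirac ()
  wait j _ y := q j (y j) (s - feedbackDelivery q s y j)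
  measurable_wait j :=
    ((hq j).comp ((measurable_pi_apply j).prodMk
      (measurable_const.sub (measurable_feedbackDelivery hq s j)))).comp measurable_snd
  wait_mem _ _ _ := hM _ _ _
  causal j _ y y' h := by rw [h j le_rfl, feedbackDelivery_congr q s j h]

/-- The recursion in `feedbackDelivery` agrees with the delivery times of the resulting path. -/
theorem deliveryTime_feedbackPolicy {M : ℝ} (q : ℕ → ℝ → ℝ → ℝ)
    (hq : ∀ j, Measurable fun p : ℝ × ℝ => q j p.1 p.2) (hM : ∀ j a r, q j a r ∈ Icc 0 M)
    (s : ℝ) (y : ℕ → ℝ) (ξ : (feedbackPolicy q hq hM s).Seed) (j : ℕ) :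
    deliveryTime y (fun i => (feedbackPolicy q hq hM s).wait i ξ y) j
      = feedbackDelivery q s y j := by
  induction j with
  | zero => rfl
  | succ j ih => simp only [deliveryTime, feedbackDelivery, ih]; rfl

namespace StationaryPolicy

variable {M : ℝ}

/-- The stationary policy as a causal policy, when the clock starts at a delivery and the query
is at time `s`. -/
def toCausal (π : StationaryPolicy M) (s : ℝ) : CausalPolicy M :=
  feedbackPolicy (fun _ => π.decision) (fun _ => π.measurable_decision)
    (fun _ => π.decision_mem) s

/-- The first request is placed at time `0`; from the next delivery on, the stationary policy is
followed. -/
def requestNow (π : StationaryPolicy M) (s : ℝ) : CausalPolicy M :=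
  feedbackPolicy (fun j a r => if j = 0 then 0 else π.decision a r)
    (fun j => by
      by_cases h : j = 0
      · simp only [h, if_true]; exact measurable_const
      · simp only [h, if_false]; exact π.measurable_decision)
    (fun j a r => by
      by_cases h : j = 0
      · simp only [h, if_true]
        exact ⟨le_rfl, (π.decision_mem 0 0).1.trans (π.decision_mem 0 0).2⟩
      · simp only [h, if_false]; exact π.decision_mem a r)
    s

end StationaryPolicy

/-! ### Costs

The delays are i.i.d. with law `μ`; `g` is the age penalty. -/

variable {M : ℝ}

/-- `E[g(Δ(Q))]` for a query at time `Q`, when update `0` is delivered at time `0` with the random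
age `Y 0 ∼ μ`. -/
def queryCost (g : ℝ → ℝ) (μ : Measure ℝ) [IsProbabilityMeasure μ] (Q : ℝ)
    (π : CausalPolicy M) : ℝ :=
  ∫ p, g (age p.2 (fun j => π.wait j p.1 p.2) Q)
    ∂(π.seedLaw.prod (Measure.infinitePi fun _ : ℕ => μ))

/-- Expected penalty at a query that is `s` time units after a delivery with age `a`, when the
causal policy `π` is applied from that delivery on. -/
def costFrom (g : ℝ → ℝ) (μ : Measure ℝ) [IsProbabilityMeasure μ] (s a : ℝ)
    (π : CausalPolicy M) : ℝ :=
  ∫ p, g (age (Function.update p.2 0 a) (fun j => π.wait j p.1 (Function.update p.2 0 a)) s)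
    ∂(π.seedLaw.prod (Measure.infinitePi fun _ : ℕ => μ))

/-- `G_D^π(s, a)`: expected penalty at the query given a delivery with remaining time `s` and
age `a`. -/
def GD (g : ℝ → ℝ) (μ : Measure ℝ) [IsProbabilityMeasure μ] (π : StationaryPolicy M)
    (s a : ℝ) : ℝ :=
  costFrom g μ s a (π.toCausal s)

/-- `G_R^π(s, b)`: expected penalty at the query given a request with remaining time `s`, the age
at the request being `b`, when `π` is followed from the next delivery on. -/
def GR (g : ℝ → ℝ) (μ : Measure ℝ) [IsProbabilityMeasure μ] (π : StationaryPolicy M)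
    (s b : ℝ) : ℝ :=
  costFrom g μ s b (π.requestNow s)

/-! ### Optimality and border points -/

/-- `π` is optimal for the single query problem with query time `Q`. -/
def IsQueryOptimal (g : ℝ → ℝ) (μ : Measure ℝ) [IsProbabilityMeasure μ] (Q : ℝ)
    (π : StationaryPolicy M) : Prop :=
  ∀ π' : CausalPolicy M, queryCost g μ Q (π.toCausal Q) ≤ queryCost g μ Q π'

/-- `π` is optimal after a delivery at any time `D ∈ [0, Q]` with any age in `[BL, BU]`. -/
def IsOptimalAtDeliveries (g : ℝ → ℝ) (μ : Measure ℝ) [IsProbabilityMeasure μ] (BL BU Q : ℝ)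
    (π : StationaryPolicy M) : Prop :=
  ∀ D ∈ Icc 0 Q, ∀ a ∈ Icc BL BU, ∀ π' : CausalPolicy M,
    GD g μ π (Q - D) a ≤ costFrom g μ (Q - D) a π'

/-- After a delivery at time `D` with age `a`, it is admissible and optimal to place the next
request at time `R` and to follow `π` afterwards. -/
def IsOptimalRequest (g : ℝ → ℝ) (μ : Measure ℝ) [IsProbabilityMeasure μ] (Q : ℝ)
    (π : StationaryPolicy M) (D a R : ℝ) : Prop :=
  R - D ∈ Icc 0 M ∧ ∀ π' : CausalPolicy M,
    GR g μ π (Q - R) (a + (R - D)) ≤ costFrom g μ (Q - D) a π'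

/-- `P` is a border point of `π` for the query `Q`: among all request times up to `Q - BU` it
minimizes the expected penalty `G_R^π(Q - R, b)`. The age `b` at the request is irrelevant for such
request times; accordingly the inequality is required for all ages on both sides. -/
def IsBorderPoint (g : ℝ → ℝ) (μ : Measure ℝ) [IsProbabilityMeasure μ] (BU Q : ℝ)
    (π : StationaryPolicy M) (P : ℝ) : Prop :=
  P ∈ Icc 0 (Q - BU) ∧ ∀ R ∈ Icc 0 (Q - BU), ∀ b ≥ 0, ∀ b' ≥ 0,
    GR g μ π (Q - P) b ≤ GR g μ π (Q - R) b'

/-- The request time chosen by `π` after a delivery at `Q - 3 BU` with age `BL`. -/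
def selectedPoint (BL BU Q : ℝ) (π : StationaryPolicy M) : ℝ :=
  (Q - 3 * BU) + π.decision BL (3 * BU)

end PullOrWait

end

noncomputable section

namespace PullOrWait

open Filter Topology
open scoped ENNReal

/-! ### Paths -/

/-! Dynamic programming in `ℝ≥0∞`. Let `V s a` be the optimal penalty after a delivery and `W r b`
(`requestValue`) the penalty of a request with remaining time `r` at age `b`, so that `V s a` is the
infimum of `W (s - z) (a + z)` over waits `z`. Each update uses up at least `BL > 0`, so only
finitely many updates matter and value iteration stops at a solution `V` (`exists_isBellmanValue`).
Conditioning on the first delay (`waitCost_eq`) shows that `V` bounds every causal policy from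
below, and that rules choosing minimizers attain it.

If `r ≥ BU`, the update surely arrives in time, and `W r b` does not depend on `b`. Let `r` now
minimize `W · 0` on `[BU, 2 * BU]`. The core is `exists_border`: `W r 0` is also at most `W r' b`
for every earlier request (`r' > 2 * BU`), and for every late one (`r' < BU`) whose age at the query
would be at least `2 * BU` without a delivery. A late request is no better than an extra request `2
* BU` before the query: that one surely arrives while the late request can still be placed, and it
only makes the age smaller. For an early request, induct over the requests that follow it.

Consequently `V s a = W r 0` for all `s ≥ 2 * BU` (`eq_border`), and waiting until the remaining
time is `r` is optimal from all these states. This gives the policy in (1). For (2), any optimal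
policy attains `V`, so its request after the delivery at `Q - 3 * BU` has value `W r 0`; if made by
`Q - BU`, it is a border point. For (3), a later selected point would be a late request with total
age `BL + 3 * BU > 2 * BU`, strictly worse than the bound at total age `2 * BU`, since it misses the
query with positive probability. -/

theorem deliveryTime_succ_eq (y w : ℕ → ℝ) (j : ℕ) :
    deliveryTime y w (j + 1)
      = w 0 + y 1 + deliveryTime (fun i => y (i + 1)) (fun i => w (i + 1)) j := by
  induction j with
  | zero => simp [deliveryTime]
  | succ j ih => rw [deliveryTime, ih, deliveryTime]; ring

theorem requestTime_succ_eq (y w : ℕ → ℝ) (j : ℕ) :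
    requestTime y w (j + 1)
      = w 0 + y 1 + requestTime (fun i => y (i + 1)) (fun i => w (i + 1)) j := by
  cases j with
  | zero => simp [requestTime, deliveryTime]
  | succ j => simp only [requestTime]; rw [deliveryTime_succ_eq]; ring

section Path

variable {y w : ℕ → ℝ}

theorem requestTime_le_deliveryTime (hy : ∀ j, 0 ≤ y j) (j : ℕ) :
    requestTime y w j ≤ deliveryTime y w j := by
  cases j with
  | zero => simpa [requestTime, deliveryTime] using hy 0
  | succ j => simpa [requestTime, deliveryTime] using hy (j + 1)

theorem deliveryTime_nonneg (hy : ∀ j, 0 ≤ y j) (hw : ∀ j, 0 ≤ w j) (j : ℕ) :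
    0 ≤ deliveryTime y w j := by
  induction j with
  | zero => exact le_rfl
  | succ j ih => have := hy (j + 1); have := hw j; rw [deliveryTime]; linarith

theorem bddAbove_requests (hy : ∀ j, 0 ≤ y j) (s : ℝ) :
    BddAbove {r | ∃ j, deliveryTime y w j ≤ s ∧ r = requestTime y w j} := by
  refine ⟨s, ?_⟩
  rintro r ⟨j, hj, rfl⟩
  exact (requestTime_le_deliveryTime hy j).trans hj

theorem age_nonneg (hy : ∀ j, 0 ≤ y j) {s : ℝ} (hs : 0 ≤ s) : 0 ≤ age y w s := by
  refine sub_nonneg.2 (csSup_le ⟨_, 0, hs, rfl⟩ ?_)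
  rintro r ⟨j, hj, rfl⟩
  exact (requestTime_le_deliveryTime hy j).trans hj

theorem age_le (hy : ∀ j, 0 ≤ y j) {s : ℝ} (hs : 0 ≤ s) : age y w s ≤ y 0 + s := by
  have : -y 0 ≤ generationTime y w s := le_csSup (bddAbove_requests hy s) ⟨0, hs, rfl⟩
  rw [age]; linarith

/-- The age at the query if the first requested update arrives too late. -/
theorem age_of_lt (hy : ∀ j, 0 ≤ y j) (hw : ∀ j, 0 ≤ w j) {s : ℝ} (hs : 0 ≤ s)
    (h : s - w 0 < y 1) : age y w s = y 0 + s := by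
  have : {r | ∃ j, deliveryTime y w j ≤ s ∧ r = requestTime y w j} = {-y 0} := by
    ext r
    constructor
    · rintro ⟨j, hj, rfl⟩
      cases j with
      | zero => rfl
      | succ j =>
        rw [deliveryTime_succ_eq] at hj
        have := deliveryTime_nonneg (y := fun i => y (i + 1)) (w := fun i => w (i + 1))
          (fun i => hy _) (fun i => hw _) j
        linarith
    · rintro rfl
      exact ⟨0, hs, rfl⟩
  rw [age, generationTime, this, csSup_singleton]; ring

/-- If the first requested update arrives before the query, the clock can be restarted at its
delivery. -/
theorem age_of_le (hy : ∀ j, 0 ≤ y j) (hw : ∀ j, 0 ≤ w j) {s : ℝ} (hs : 0 ≤ s)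
    (h : y 1 ≤ s - w 0) :
    age y w s = age (fun i => y (i + 1)) (fun i => w (i + 1)) (s - w 0 - y 1) := by
  suffices IsLUB {r | ∃ j, deliveryTime y w j ≤ s ∧ r = requestTime y w j}
      (w 0 + y 1 + generationTime (fun i => y (i + 1)) (fun i => w (i + 1)) (s - w 0 - y 1)) by
    rw [age, generationTime, this.csSup_eq ⟨_, 0, hs, rfl⟩, age]; ring
  have hb := bddAbove_requests (y := fun i => y (i + 1)) (w := fun i => w (i + 1))
    (fun i => hy _) (s - w 0 - y 1)
  constructor
  · rintro r ⟨j, hj, rfl⟩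
    cases j with
    | zero =>
      -- Request 0 has no counterpart in the restarted path, but it lies at `-y 0 ≤ 0 ≤ w 0`, hence
      -- not after request 1.
      have : -y 1 ≤ generationTime (fun i => y (i + 1)) (fun i => w (i + 1)) (s - w 0 - y 1) :=
        le_csSup hb ⟨0, by rw [deliveryTime]; linarith, rfl⟩
      have := hw 0
      have := hy 0
      rw [requestTime]; linarith
    | succ j =>
      rw [requestTime_succ_eq]
      rw [deliveryTime_succ_eq] at hj
      gcongr
      exact le_csSup hb ⟨j, by linarith, rfl⟩
  · intro u hu
    rw [← le_sub_iff_add_le']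
    refine csSup_le ⟨_, 0, by rw [deliveryTime]; linarith, rfl⟩ ?_
    rintro r ⟨j, hj, rfl⟩
    rw [le_sub_iff_add_le', ← requestTime_succ_eq]
    exact hu ⟨j + 1, by rw [deliveryTime_succ_eq]; linarith, rfl⟩

end Path

theorem measurable_deliveryTime {Ω : Type*} [MeasurableSpace Ω] {y w : Ω → ℕ → ℝ}
    (hy : Measurable y) (hw : ∀ j, Measurable fun x => w x j) (j : ℕ) :
    Measurable fun x => deliveryTime (y x) (w x) j := by
  induction j with
  | zero => exact measurable_const
  | succ j ih => exact (ih.add (hw j)).add ((measurable_pi_apply (j + 1)).comp hy)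

theorem measurable_requestTime {Ω : Type*} [MeasurableSpace Ω] {y w : Ω → ℕ → ℝ}
    (hy : Measurable y) (hw : ∀ j, Measurable fun x => w x j) (j : ℕ) :
    Measurable fun x => requestTime (y x) (w x) j := by
  cases j with
  | zero => exact ((measurable_pi_apply 0).comp hy).neg
  | succ j => exact (measurable_deliveryTime hy hw j).add (hw j)

theorem measurable_age {Ω : Type*} [MeasurableSpace Ω] {y w : Ω → ℕ → ℝ}
    (hy : Measurable y) (hw : ∀ j, Measurable fun x => w x j) {s : ℝ} (hs : 0 ≤ s) :
    Measurable fun x => age (y x) (w x) s := by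
  -- The default `-y x 0` is itself in the set, as delivery 0 has occurred by time `s ≥ 0`; this
  -- gives a supremum over a fixed countable index set.
  have key : ∀ x, generationTime (y x) (w x) s
      = ⨆ j, if deliveryTime (y x) (w x) j ≤ s then requestTime (y x) (w x) j else -y x 0 := by
    intro x
    rw [generationTime, iSup]
    congr 1
    ext r
    constructor
    · rintro ⟨j, hj, rfl⟩
      exact ⟨j, if_pos hj⟩
    · rintro ⟨j, rfl⟩
      by_cases hj : deliveryTime (y x) (w x) j ≤ s
      · exact ⟨j, hj, if_pos hj⟩
      · exact ⟨0, hs, if_neg hj⟩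
  simp only [age, key]
  refine measurable_const.sub (Measurable.iSup fun j => Measurable.ite ?_ ?_ ?_)
  · exact measurableSet_le (measurable_deliveryTime hy hw j) measurable_const
  · exact measurable_requestTime hy hw j
  · exact ((measurable_pi_apply 0).comp hy).neg

/-! ### Splitting off the first delay -/

/-- The sequence `a, y 0, y 1, …`. -/
def cons (a : ℝ) (y : ℕ → ℝ) : ℕ → ℝ
  | 0 => a
  | n + 1 => y n

@[simp] theorem cons_zero (a : ℝ) (y : ℕ → ℝ) : cons a y 0 = a := rfl

@[simp] theorem cons_succ (a : ℝ) (y : ℕ → ℝ) (n : ℕ) : cons a y (n + 1) = y n := rfl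

@[simp] theorem update_cons (a x : ℝ) (y : ℕ → ℝ) :
    Function.update (cons x y) 0 a = cons a y := by
  ext n
  cases n <;> simp [Function.update]

theorem measurable_cons : Measurable fun p : ℝ × (ℕ → ℝ) => cons p.1 p.2 := by
  refine measurable_pi_lambda _ fun n => ?_
  cases n with
  | zero => exact measurable_fst
  | succ n => exact (measurable_pi_apply n).comp measurable_snd

/-- Checked on finite cylinders: coordinate 0 contributes its own factor, and the rest is a cylinder
with indices lowered by one. -/
theorem map_cons (μ : Measure ℝ) [IsProbabilityMeasure μ] :
    (μ.prod (Measure.infinitePi fun _ : ℕ => μ)).map (fun p => cons p.1 p.2)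
      = Measure.infinitePi fun _ : ℕ => μ := by
  refine Measure.eq_infinitePi (fun _ => μ) fun s t ht => ?_
  classical
  have hs : ∀ y : ℕ → ℝ, ∀ a, cons a y ∈ Set.pi (s : Set ℕ) t ↔
      (0 ∈ s → a ∈ t 0) ∧ ∀ n ∈ s.preimage Nat.succ (Nat.succ_injective.injOn),
        y n ∈ t (n + 1) := by
    intro y a
    constructor
    · intro h
      exact ⟨fun h0 => h 0 h0, fun n hn => h (n + 1) (by simpa using hn)⟩
    · rintro ⟨h0, h⟩ n hn
      cases n with
      | zero => exact h0 hn
      | succ n => exact h n (by simpa using hn)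
  have hpre : (fun p : ℝ × (ℕ → ℝ) => cons p.1 p.2) ⁻¹' Set.pi (s : Set ℕ) t
      = (if 0 ∈ s then t 0 else univ) ×ˢ
        Set.pi ((s.preimage Nat.succ (Nat.succ_injective.injOn) : Finset ℕ) : Set ℕ)
          fun n => t (n + 1) := by
    ext ⟨a, y⟩
    rw [mem_preimage, hs, mem_prod]
    refine and_congr ?_ Iff.rfl
    split_ifs with h <;> simp [h]
  rw [Measure.map_apply measurable_cons (MeasurableSet.pi s.countable_toSet fun i _ => ht i),
    hpre, Measure.prod_prod, Measure.infinitePi_pi (fun _ => μ) fun i _ => ht _]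
  have himg : (s.preimage Nat.succ (Nat.succ_injective.injOn)).image Nat.succ = s.erase 0 := by
    ext n
    cases n <;> simp
  have hprod : ∏ i ∈ s.preimage Nat.succ (Nat.succ_injective.injOn), μ (t (i + 1))
      = ∏ i ∈ s.erase 0, μ (t i) := by
    rw [← himg, Finset.prod_image Nat.succ_injective.injOn]
  rw [hprod]
  split_ifs with h
  · exact Finset.mul_prod_erase s (fun i => μ (t i)) h
  · rw [measure_univ, one_mul, Finset.erase_eq_of_notMem h]

theorem lintegral_infinitePi_cons (μ : Measure ℝ) [IsProbabilityMeasure μ]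
    {F : (ℕ → ℝ) → ℝ≥0∞} (hF : Measurable F) :
    ∫⁻ y, F y ∂(Measure.infinitePi fun _ : ℕ => μ)
      = ∫⁻ a, ∫⁻ y, F (cons a y) ∂(Measure.infinitePi fun _ : ℕ => μ) ∂μ := by
  conv_lhs => rw [← map_cons μ]
  rw [lintegral_map hF measurable_cons]
  exact lintegral_prod _ (hF.comp measurable_cons).aemeasurable

theorem lintegral_infinitePi_update (μ : Measure ℝ) [IsProbabilityMeasure μ]
    {F : (ℕ → ℝ) → ℝ≥0∞} (hF : Measurable F) (a : ℝ) :
    ∫⁻ y, F (Function.update y 0 a) ∂(Measure.infinitePi fun _ : ℕ => μ)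
      = ∫⁻ y, F (cons a y) ∂(Measure.infinitePi fun _ : ℕ => μ) := by
  have hm : Measurable fun y : ℕ → ℝ => F (Function.update y 0 a) :=
    hF.comp (by fun_prop : Measurable fun y : ℕ → ℝ => Function.update y 0 a)
  rw [lintegral_infinitePi_cons μ hm]
  simp

theorem ae_infinitePi_mem (μ : Measure ℝ) [IsProbabilityMeasure μ] {s : Set ℝ}
    (hs : ∀ᵐ x ∂μ, x ∈ s) :
    ∀ᵐ y ∂(Measure.infinitePi fun _ : ℕ => μ), ∀ j, y j ∈ s := by
  rw [ae_all_iff]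
  intro j
  exact (measurePreserving_eval_infinitePi (fun _ : ℕ => μ) j).quasiMeasurePreserving.ae hs

/-! ### Lower semicontinuity and measurable selection -/

/-- Fatou's lemma along the neighbourhood filter. -/
theorem lowerSemicontinuous_lintegral {X α : Type*} [TopologicalSpace X]
    [FirstCountableTopology X] [MeasurableSpace α] (μ : Measure α) {f : X → α → ℝ≥0∞}
    (hm : ∀ x, Measurable (f x)) (hf : ∀ a, LowerSemicontinuous fun x => f x a) :
    LowerSemicontinuous fun x => ∫⁻ a, f x a ∂μ := by
  rw [lowerSemicontinuous_iff_le_liminf]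
  intro x
  calc ∫⁻ a, f x a ∂μ ≤ ∫⁻ a, liminf (fun x' => f x' a) (𝓝 x) ∂μ :=
        lintegral_mono fun a => (hf a).le_liminf x
    _ ≤ liminf (fun x' => ∫⁻ a, f x' a ∂μ) (𝓝 x) := lintegral_liminf_le hm

section Argmin

variable {X : Type*} [TopologicalSpace X] {f : X → ℝ → ℝ≥0∞} {M : ℝ}

theorem exists_iInf_Icc_eq (hf : LowerSemicontinuous fun p : X × ℝ => f p.1 p.2) (hM : 0 ≤ M)
    (x : X) : ∃ z ∈ Icc 0 M, f x z = ⨅ z' ∈ Icc 0 M, f x z' := by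
  have h1 : LowerSemicontinuous (f x) := hf.comp (by fun_prop : Continuous fun z : ℝ => (x, z))
  obtain ⟨z, hz, hmin⟩ := (h1.lowerSemicontinuousOn (Icc 0 M)).exists_isMinOn
    (nonempty_Icc.2 hM) isCompact_Icc
  exact ⟨z, hz, le_antisymm (le_iInf₂ fun z' hz' => hmin hz') (iInf₂_le z hz)⟩

/-- Minima are attained, so sublevel sets are projections of closed sets along the compact factor
`[0, M]`, hence closed. -/
theorem lowerSemicontinuous_iInf_Icc (hf : LowerSemicontinuous fun p : X × ℝ => f p.1 p.2)
    (hM : 0 ≤ M) : LowerSemicontinuous fun x => ⨅ z ∈ Icc 0 M, f x z := by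
  rw [lowerSemicontinuous_iff_isClosed_preimage]
  intro c
  have hg : LowerSemicontinuous fun p : X × Icc 0 M => f p.1 p.2 :=
    hf.comp (by fun_prop : Continuous fun p : X × Icc 0 M => (p.1, (p.2 : ℝ)))
  have : (fun x => ⨅ z ∈ Icc 0 M, f x z) ⁻¹' Iic c
      = Prod.fst '' ((fun p : X × Icc 0 M => f p.1 p.2) ⁻¹' Iic c) := by
    ext x
    constructor
    · intro hx
      obtain ⟨z, hz, he⟩ := exists_iInf_Icc_eq hf hM x
      exact ⟨(x, ⟨z, hz⟩), he.trans_le hx, rfl⟩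
    · rintro ⟨⟨x', z⟩, h, rfl⟩
      exact (iInf₂_le (f := fun z' _ => f x' z') z.1 z.2).trans h
  rw [this]
  exact isClosedMap_fst_of_compactSpace _ (hg.isClosed_preimage c)

/-- A jointly lower semicontinuous function has a measurable minimizer over `[0, M]`. -/
theorem exists_measurable_argmin [MeasurableSpace X] [OpensMeasurableSpace X]
    (hf : LowerSemicontinuous fun p : X × ℝ => f p.1 p.2) (hM : 0 ≤ M) :
    ∃ z : X → ℝ, Measurable z ∧ (∀ x, z x ∈ Icc 0 M) ∧
      ∀ x, f x (z x) = ⨅ z' ∈ Icc 0 M, f x z' := by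
  set m : X → ℝ≥0∞ := fun x => ⨅ z' ∈ Icc 0 M, f x z' with hm
  set S : X → Set ℝ := fun x => Icc 0 M ∩ f x ⁻¹' Iic (m x) with hS
  have hSc : ∀ x, IsCompact (S x) := fun x =>
    isCompact_Icc.inter_right
      ((hf.comp (by fun_prop : Continuous fun z : ℝ => (x, z))).isClosed_preimage _)
  have hSn : ∀ x, (S x).Nonempty := fun x => by
    obtain ⟨z, hz, he⟩ := exists_iInf_Icc_eq hf hM x
    exact ⟨z, hz, he.le⟩
  have hmem : ∀ x, sInf (S x) ∈ S x := fun x => (hSc x).sInf_mem (hSn x)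
  refine ⟨fun x => sInf (S x), ?_, fun x => (hmem x).1, fun x =>
    le_antisymm (hmem x).2 (iInf₂_le _ (hmem x).1)⟩
  refine measurable_of_Iic fun c => ?_
  rcases lt_or_ge c 0 with hc | hc
  · convert! MeasurableSet.empty
    ext x
    simpa using hc.trans_le (hmem x).1.1
  · have hc' : 0 ≤ min c M := le_min hc hM
    -- The selected minimizer is the least one. It is at most `c` exactly when the minimum over the
    -- shorter interval already reaches the overall minimum, a comparison of two measurable
    -- functions.
    have : (fun x => sInf (S x)) ⁻¹' Iic c = {x | ⨅ z' ∈ Icc 0 (min c M), f x z' ≤ m x} := by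
      ext x
      constructor
      · intro hx
        exact (iInf₂_le (f := fun z' _ => f x z') (sInf (S x))
          ⟨(hmem x).1.1, le_min hx (hmem x).1.2⟩).trans (hmem x).2
      · intro hx
        obtain ⟨z, hz, he⟩ := exists_iInf_Icc_eq hf hc' x
        exact (csInf_le (hSc x).bddBelow ⟨⟨hz.1, hz.2.trans (min_le_right _ _)⟩,
          he.le.trans hx⟩).trans (hz.2.trans (min_le_left _ _))
    rw [this]
    exact measurableSet_le (lowerSemicontinuous_iInf_Icc hf hc').measurable
      (lowerSemicontinuous_iInf_Icc hf hM).measurable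

end Argmin

/-! ### Dynamic programming -/

section Bellman

variable (G : ℝ → ℝ≥0∞) (μ : Measure ℝ)

/-- Expected penalty after a request at age `b` with remaining time `r`, when `V` is the penalty
after the next delivery. The minimum with the penalty of never receiving an update makes this lower
semicontinuous without a sign condition on `b`. -/
def requestValue (V : ℝ → ℝ → ℝ≥0∞) (r b : ℝ) : ℝ≥0∞ :=
  ∫⁻ y, if y ≤ r then min (V (r - y) y) (G (b + r)) else G (b + r) ∂μ

/-- `V` is a regular solution of the optimality equation for remaining times in `[0, Q]`. -/
structure IsBellmanValue (M Q : ℝ) (V : ℝ → ℝ → ℝ≥0∞) : Prop where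
  lowerSemicontinuous : LowerSemicontinuous fun p : ℝ × ℝ => V p.1 p.2
  le : ∀ s a, V s a ≤ G (a + s)
  eq_iInf : ∀ s ∈ Icc 0 Q, ∀ a, V s a = ⨅ z ∈ Icc 0 M, requestValue G μ V (s - z) (a + z)

variable {G μ}

theorem requestValue_le [IsProbabilityMeasure μ] (V : ℝ → ℝ → ℝ≥0∞) (r b : ℝ) :
    requestValue G μ V r b ≤ G (b + r) := by
  calc requestValue G μ V r b ≤ ∫⁻ _, G (b + r) ∂μ := by
        refine lintegral_mono fun y => ?_
        dsimp only
        split_ifs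
        · exact min_le_right _ _
        · exact le_rfl
    _ = G (b + r) := by simp

theorem requestValue_mono (hG : Monotone G) (V : ℝ → ℝ → ℝ≥0∞) (r : ℝ) :
    Monotone (requestValue G μ V r) := by
  intro b b' h
  have hb : G (b + r) ≤ G (b' + r) := hG (by linarith)
  refine lintegral_mono fun y => ?_
  dsimp only
  split_ifs
  · exact min_le_min le_rfl hb
  · exact hb

theorem measurable_requestValue_integrand {V : ℝ → ℝ → ℝ≥0∞}
    (hV : LowerSemicontinuous fun p : ℝ × ℝ => V p.1 p.2) (r c : ℝ) :
    Measurable fun y => if y ≤ r then min (V (r - y) y) (G c) else G c := by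
  refine Measurable.ite measurableSet_Iic ?_ measurable_const
  have : Measurable fun y : ℝ => V (r - y) y :=
    hV.measurable.comp (by fun_prop : Measurable fun y : ℝ => (r - y, y))
  exact this.min measurable_const

theorem lowerSemicontinuous_requestValue (hG : Continuous G) {V : ℝ → ℝ → ℝ≥0∞}
    (hV : LowerSemicontinuous fun p : ℝ × ℝ => V p.1 p.2) :
    LowerSemicontinuous fun p : ℝ × ℝ => requestValue G μ V p.1 p.2 := by
  refine lowerSemicontinuous_lintegral μ
    (fun p => measurable_requestValue_integrand hV p.1 (p.2 + p.1)) fun y => ?_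
  rintro ⟨r, b⟩ c hc
  dsimp only at hc
  have hcG : c < G (b + r) := by
    refine hc.trans_le ?_
    split_ifs
    · exact min_le_right _ _
    · exact le_rfl
  have hG' : ∀ᶠ p : ℝ × ℝ in 𝓝 (r, b), c < G (p.2 + p.1) :=
    (hG.comp (by fun_prop : Continuous fun p : ℝ × ℝ => p.2 + p.1)).continuousAt.eventually
      (lt_mem_nhds hcG)
  -- If `y ≤ r`, nearby points may fall in either branch, and the minimum in `requestValue` keeps
  -- both above `c`. If `r < y`, the late branch persists nearby.
  rcases le_or_gt y r with h | h
  · rw [if_pos h] at hc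
    have hV' : LowerSemicontinuous fun p : ℝ × ℝ => V (p.1 - y) y :=
      hV.comp (by fun_prop : Continuous fun p : ℝ × ℝ => (p.1 - y, y))
    filter_upwards [hG', hV' (r, b) c (hc.trans_le (min_le_left _ _))] with p h1 h2
    split_ifs
    · exact lt_min h2 h1
    · exact h1
  · have : ∀ᶠ p : ℝ × ℝ in 𝓝 (r, b), p.1 < y := continuous_fst.continuousAt.eventually
      (gt_mem_nhds h)
    filter_upwards [hG', this] with p h1 h2
    rwa [if_neg (not_le.2 h2)]

variable (G μ) in
/-- The optimal penalty after a delivery when only the next `n` updates count. -/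
def valueIter (M : ℝ) : ℕ → ℝ → ℝ → ℝ≥0∞
  | 0 => fun s a => G (a + s)
  | n + 1 => fun s a => ⨅ z ∈ Icc 0 M, requestValue G μ (valueIter M n) (s - z) (a + z)

variable {M : ℝ}

theorem valueIter_succ (n : ℕ) (s a : ℝ) : valueIter G μ M (n + 1) s a
    = ⨅ z ∈ Icc 0 M, requestValue G μ (valueIter G μ M n) (s - z) (a + z) := rfl

theorem lowerSemicontinuous_requestValue_wait (hG : Continuous G) {V : ℝ → ℝ → ℝ≥0∞}
    (hV : LowerSemicontinuous fun p : ℝ × ℝ => V p.1 p.2) :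
    LowerSemicontinuous fun p : (ℝ × ℝ) × ℝ =>
      requestValue G μ V (p.1.2 - p.2) (p.1.1 + p.2) :=
  (lowerSemicontinuous_requestValue hG hV).comp
    (by fun_prop : Continuous fun p : (ℝ × ℝ) × ℝ => (p.1.2 - p.2, p.1.1 + p.2))

theorem lowerSemicontinuous_valueIter (hG : Continuous G) (hM : 0 ≤ M) (n : ℕ) :
    LowerSemicontinuous fun p : ℝ × ℝ => valueIter G μ M n p.1 p.2 := by
  induction n with
  | zero =>
    exact (hG.comp (by fun_prop : Continuous fun p : ℝ × ℝ => p.2 + p.1)).lowerSemicontinuous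
  | succ n ih =>
    have h := lowerSemicontinuous_iInf_Icc (X := ℝ × ℝ)
      (f := fun p z => requestValue G μ (valueIter G μ M n) (p.2 - z) (p.1 + z))
      (lowerSemicontinuous_requestValue_wait hG ih) hM
    have hs : Continuous fun p : ℝ × ℝ => (p.2, p.1) := by fun_prop
    have h' := LowerSemicontinuous.comp h hs
    simpa only [valueIter_succ, Function.comp_def] using h'

theorem valueIter_le [IsProbabilityMeasure μ] (hM : 0 ≤ M) (n : ℕ) (s a : ℝ) :
    valueIter G μ M n s a ≤ G (a + s) := by
  cases n with
  | zero => exact le_rfl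
  | succ n =>
    refine (iInf₂_le 0 ⟨le_rfl, hM⟩).trans ((requestValue_le _ _ _).trans_eq ?_)
    simp

/-- With less than `n * BL` time left, fewer than `n` further updates can arrive, so allowing one
more changes nothing. -/
theorem valueIter_succ_eq {BL BU : ℝ} (hμ : ∀ᵐ y ∂μ, y ∈ Icc BL BU) (n : ℕ) :
    ∀ s a, 0 ≤ s → s < n * BL → valueIter G μ M (n + 1) s a = valueIter G μ M n s a := by
  induction n with
  | zero => intro s a h0 h; simp at h; linarith
  | succ n ih =>
    intro s a _ h
    push_cast at h
    rw [valueIter_succ, valueIter_succ n]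
    refine iInf_congr fun z => iInf_congr fun hz => lintegral_congr_ae ?_
    filter_upwards [hμ] with y hy
    split_ifs with hyz
    · rw [ih _ _ (by linarith) (by linarith [hz.1, hy.1])]
    · rfl

theorem exists_isBellmanValue [IsProbabilityMeasure μ] (hG : Continuous G) (hM : 0 ≤ M)
    {BL BU : ℝ} (hBL : 0 < BL) (hμ : ∀ᵐ y ∂μ, y ∈ Icc BL BU) (Q : ℝ) :
    ∃ V, IsBellmanValue G μ M Q V := by
  obtain ⟨n, hn⟩ := exists_nat_gt (Q / BL)
  rw [div_lt_iff₀ hBL] at hn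
  refine ⟨valueIter G μ M n, lowerSemicontinuous_valueIter hG hM n, valueIter_le hM n,
    fun s hs a => ?_⟩
  rw [← valueIter_succ_eq hμ n s a hs.1 (hs.2.trans_lt hn), valueIter]

end Bellman

/-! ### Deterministic waiting rules -/

/-- Properties of the waiting periods of a causal policy for a fixed value of the seed. -/
structure IsWaitRule (M : ℝ) (w : ℕ → (ℕ → ℝ) → ℝ) : Prop where
  measurable : ∀ j, Measurable (w j)
  mem : ∀ j y, w j y ∈ Icc 0 M
  causal : ∀ j y y', (∀ i ≤ j, y i = y' i) → w j y = w j y'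

/-- The rule applied from the next delivery on, when the present age is `a`. -/
def shiftRule (w : ℕ → (ℕ → ℝ) → ℝ) (a : ℝ) : ℕ → (ℕ → ℝ) → ℝ :=
  fun j y => w (j + 1) (cons a y)

theorem IsWaitRule.shift {M : ℝ} {w : ℕ → (ℕ → ℝ) → ℝ} (hw : IsWaitRule M w) (a : ℝ) :
    IsWaitRule M (shiftRule w a) where
  measurable j := (hw.measurable (j + 1)).comp
    (measurable_cons.comp (by fun_prop : Measurable fun y : ℕ → ℝ => (a, y)))
  mem j y := hw.mem _ _
  causal j y y' h := by
    refine hw.causal _ _ _ fun i hi => ?_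
    cases i with
    | zero => rfl
    | succ i => exact h i (by omega)

theorem CausalPolicy.isWaitRule {M : ℝ} (π : CausalPolicy M) (ξ : π.Seed) :
    IsWaitRule M (fun j => π.wait j ξ) where
  measurable j := (π.measurable_wait j).comp measurable_prodMk_left
  mem j y := π.wait_mem j ξ y
  causal j := π.causal j ξ

section WaitCost

variable (G : ℝ → ℝ≥0∞) (μ : Measure ℝ) [IsProbabilityMeasure μ]

/-- Expected penalty under a deterministic waiting rule, `s` time units before the query and with
age `a`. -/
def waitCost (w : ℕ → (ℕ → ℝ) → ℝ) (s a : ℝ) : ℝ≥0∞ :=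
  ∫⁻ y, G (age (cons a y) (fun j => w j (cons a y)) s) ∂(Measure.infinitePi fun _ : ℕ => μ)

variable {G μ} {M BL BU : ℝ} {w : ℕ → (ℕ → ℝ) → ℝ}

/-- Conditioning on the next delivery. -/
theorem waitCost_eq (hG : Measurable G) (hBL : 0 < BL) (hμ : ∀ᵐ y ∂μ, y ∈ Icc BL BU)
    (hw : IsWaitRule M w) {s a : ℝ} (hs : 0 ≤ s) (ha : 0 ≤ a) :
    waitCost G μ w s a = ∫⁻ y, if y ≤ s - w 0 (fun _ => a) then
      waitCost G μ (shiftRule w a) (s - w 0 (fun _ => a) - y) y else G (a + s) ∂μ := by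
  have h0 : ∀ y, w 0 (cons a y) = w 0 (fun _ => a) := fun y =>
    hw.causal _ _ _ fun i hi => by
      obtain rfl : i = 0 := by omega
      rfl
  have hc : Measurable fun y : ℕ → ℝ => cons a y :=
    measurable_cons.comp (by fun_prop : Measurable fun y : ℕ → ℝ => (a, y))
  have hF : Measurable fun y : ℕ → ℝ => G (age (cons a y) (fun j => w j (cons a y)) s) :=
    hG.comp (measurable_age hc (fun j => (hw.measurable j).comp hc) hs)
  rw [waitCost, lintegral_infinitePi_cons μ hF]
  refine lintegral_congr_ae ?_
  filter_upwards [hμ] with x hx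
  have hae : ∀ᵐ y ∂(Measure.infinitePi fun _ : ℕ => μ), ∀ j, 0 ≤ cons a (cons x y) j := by
    filter_upwards [ae_infinitePi_mem μ hμ] with y hy j
    match j with
    | 0 => exact ha
    | 1 => exact hBL.le.trans hx.1
    | j + 2 => exact hBL.le.trans (hy j).1
  have hwn : ∀ y j, 0 ≤ w j y := fun y j => (hw.mem j y).1
  split_ifs with h
  · refine lintegral_congr_ae ?_
    filter_upwards [hae] with y hy
    congr 1
    refine (age_of_le hy (fun j => hwn _ j) hs (by rw [h0]; exact h)).trans ?_
    rw [h0]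
    rfl
  · rw [lintegral_congr_ae (g := fun _ => G (a + s))]
    · simp
    · filter_upwards [hae] with y hy
      rw [age_of_lt hy (fun j => hwn _ j) hs (by rw [h0]; exact not_le.1 h), cons_zero]

/-- A solution of the optimality equation is a lower bound for every waiting rule. -/
theorem IsBellmanValue.le_waitCost {V : ℝ → ℝ → ℝ≥0∞} {Q : ℝ} (hV : IsBellmanValue G μ M Q V)
    (hG : Measurable G) (hBL : 0 < BL) (hμ : ∀ᵐ y ∂μ, y ∈ Icc BL BU)
    (hw : IsWaitRule M w) {s a : ℝ} (hs : s ∈ Icc 0 Q) (ha : 0 ≤ a) :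
    V s a ≤ waitCost G μ w s a := by
  obtain ⟨n, hn⟩ := exists_nat_gt (s / BL)
  rw [div_lt_iff₀ hBL] at hn
  induction n generalizing w s a with
  | zero => simp at hn; linarith [hs.1]
  | succ n ih =>
    push_cast at hn
    have hw0 := hw.mem 0 (fun _ => a)
    rw [hV.eq_iInf s hs a, waitCost_eq hG hBL hμ hw hs.1 ha]
    refine (iInf₂_le _ hw0).trans (lintegral_mono_ae ?_)
    filter_upwards [hμ] with y hy
    split_ifs with h
    · exact (min_le_left _ _).trans (ih (hw.shift a)
        ⟨by linarith, by linarith [hs.2, hw0.1, hy.1]⟩ (hBL.le.trans hy.1)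
        (by linarith [hw0.1, hy.1]))
    · apply le_of_eq; congr 1; ring

theorem waitCost_le (hG : Monotone G) (hBL : 0 < BL) (hμ : ∀ᵐ y ∂μ, y ∈ Icc BL BU) {s a : ℝ}
    (hs : 0 ≤ s) (ha : 0 ≤ a) : waitCost G μ w s a ≤ G (a + s) := by
  calc waitCost G μ w s a ≤ ∫⁻ _, G (a + s) ∂(Measure.infinitePi fun _ : ℕ => μ) := by
        refine lintegral_mono_ae ?_
        filter_upwards [ae_infinitePi_mem μ hμ] with y hy
        refine hG (age_le (y := cons a y) (fun j => ?_) hs)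
        cases j with
        | zero => exact ha
        | succ j => exact hBL.le.trans (hy j).1
    _ = G (a + s) := by simp

end WaitCost

/-! ### Feedback rules -/

section Feedback

/-- The waiting periods of `feedbackPolicy`. -/
def feedbackRule (q : ℕ → ℝ → ℝ → ℝ) (s : ℝ) : ℕ → (ℕ → ℝ) → ℝ :=
  fun j y => q j (y j) (s - feedbackDelivery q s y j)

variable {q : ℕ → ℝ → ℝ → ℝ} {M : ℝ}

theorem isWaitRule_feedbackRule (hq : ∀ j, Measurable fun p : ℝ × ℝ => q j p.1 p.2)
    (hM : ∀ j a r, q j a r ∈ Icc 0 M) (s : ℝ) : IsWaitRule M (feedbackRule q s) :=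
  (feedbackPolicy q hq hM s).isWaitRule ()

theorem feedbackDelivery_succ_eq (s : ℝ) (y : ℕ → ℝ) (j : ℕ) :
    feedbackDelivery q s y (j + 1) = q 0 (y 0) s + y 1
      + feedbackDelivery (fun i => q (i + 1)) (s - q 0 (y 0) s - y 1) (fun i => y (i + 1)) j := by
  induction j with
  | zero => simp [feedbackDelivery]
  | succ j ih =>
    rw [feedbackDelivery, ih, feedbackDelivery]
    have : s - (q 0 (y 0) s + y 1 + feedbackDelivery (fun i => q (i + 1))
        (s - q 0 (y 0) s - y 1) (fun i => y (i + 1)) j)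
        = s - q 0 (y 0) s - y 1 - feedbackDelivery (fun i => q (i + 1))
        (s - q 0 (y 0) s - y 1) (fun i => y (i + 1)) j := by ring
    rw [this]; ring

/-- Feedback depends on the past only through the present age and remaining time, so the shifted
rule is again a feedback rule. Stage dependence lets `toCausal` and `requestNow` share one argument.
-/
theorem shiftRule_feedbackRule (s a x : ℝ) (y : ℕ → ℝ) (j : ℕ) :
    shiftRule (feedbackRule q s) a j (cons x y)
      = feedbackRule (fun i => q (i + 1)) (s - q 0 a s - x) j (cons x y) := by
  rw [shiftRule, feedbackRule, feedbackDelivery_succ_eq, feedbackRule]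
  simp only [cons_zero, cons_succ]
  congr 1
  ring

variable {G : ℝ → ℝ≥0∞} {μ : Measure ℝ} [IsProbabilityMeasure μ] {BL BU : ℝ}

theorem waitCost_feedbackRule (hG : Measurable G) (hBL : 0 < BL)
    (hμ : ∀ᵐ y ∂μ, y ∈ Icc BL BU) (hq : ∀ j, Measurable fun p : ℝ × ℝ => q j p.1 p.2)
    (hM : ∀ j a r, q j a r ∈ Icc 0 M) {s a : ℝ} (hs : 0 ≤ s) (ha : 0 ≤ a) :
    waitCost G μ (feedbackRule q s) s a = ∫⁻ y, if y ≤ s - q 0 a s then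
      waitCost G μ (feedbackRule (fun i => q (i + 1)) (s - q 0 a s - y)) (s - q 0 a s - y) y
      else G (a + s) ∂μ := by
  rw [waitCost_eq hG hBL hμ (isWaitRule_feedbackRule hq hM s) hs ha]
  have h0 : feedbackRule q s 0 (fun _ => a) = q 0 a s := by simp [feedbackRule, feedbackDelivery]
  simp only [h0]
  congr! 3 with x
  simp only [waitCost, shiftRule_feedbackRule]

theorem IsBellmanValue.waitCost_feedbackRule_eq {V : ℝ → ℝ → ℝ≥0∞} {Q : ℝ}
    (hV : IsBellmanValue G μ M Q V) (hG : Measurable G) (hGm : Monotone G) (hBL : 0 < BL)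
    (hμ : ∀ᵐ y ∂μ, y ∈ Icc BL BU) (hq : ∀ j, Measurable fun p : ℝ × ℝ => q j p.1 p.2)
    (hM : ∀ j a r, q j a r ∈ Icc 0 M) {s a : ℝ} (hs : s ∈ Icc 0 Q) (ha : 0 ≤ a)
    (hnext : ∀ r ∈ Icc 0 Q, ∀ x ∈ Icc BL BU,
      waitCost G μ (feedbackRule (fun i => q (i + 1)) r) r x = V r x) :
    waitCost G μ (feedbackRule q s) s a = requestValue G μ V (s - q 0 a s) (a + q 0 a s) := by
  rw [waitCost_feedbackRule hG hBL hμ hq hM hs.1 ha]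
  refine lintegral_congr_ae ?_
  have hq0 := hM 0 a s
  filter_upwards [hμ] with y hy
  have hGe : G (a + q 0 a s + (s - q 0 a s)) = G (a + s) := by congr 1; ring
  rw [hGe]
  split_ifs with h
  · rw [hnext _ ⟨by linarith, by linarith [hs.2, hq0.1, hy.1]⟩ y hy, min_eq_left]
    exact (hV.le _ _).trans (hGm (by linarith [hq0.1]))
  · rfl

/-- A stationary rule that attains the minimum in the optimality equation attains the value. -/
theorem IsBellmanValue.waitCost_stationary {V : ℝ → ℝ → ℝ≥0∞} {Q : ℝ}
    (hV : IsBellmanValue G μ M Q V) (hG : Measurable G) (hGm : Monotone G) (hBL : 0 < BL)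
    (hμ : ∀ᵐ y ∂μ, y ∈ Icc BL BU) (π : StationaryPolicy M)
    (hπ : ∀ s ∈ Icc 0 Q, ∀ a ∈ Icc BL BU,
      requestValue G μ V (s - π.decision a s) (a + π.decision a s) = V s a)
    {s a : ℝ} (hs : s ∈ Icc 0 Q) (ha : a ∈ Icc BL BU) :
    waitCost G μ (feedbackRule (fun _ => π.decision) s) s a = V s a := by
  obtain ⟨n, hn⟩ := exists_nat_gt (s / BL)
  rw [div_lt_iff₀ hBL] at hn
  induction n generalizing s a with
  | zero => simp at hn; linarith [hs.1]
  | succ n ih =>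
    push_cast at hn
    rw [← hπ s hs a ha, waitCost_feedbackRule hG hBL hμ (fun _ => π.measurable_decision)
      (fun _ => π.decision_mem) hs.1 (hBL.le.trans ha.1)]
    refine lintegral_congr_ae ?_
    have hq0 := π.decision_mem a s
    filter_upwards [hμ] with y hy
    have hGe : G (a + π.decision a s + (s - π.decision a s)) = G (a + s) := by congr 1; ring
    rw [hGe]
    split_ifs with h
    · rw [ih ⟨by linarith, by linarith [hs.2, hq0.1, hy.1]⟩ hy (by linarith [hq0.1, hy.1]),
        min_eq_left]
      exact (hV.le _ _).trans (hGm (by linarith [hq0.1, ha.1]))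
    · rfl

end Feedback

/-! ### Request times at which an update is sure to arrive before the query -/

section Border

variable {G : ℝ → ℝ≥0∞} {μ : Measure ℝ} {M Q BL BU : ℝ} {V : ℝ → ℝ → ℝ≥0∞}

/-- Arrival before the query is certain, so the old age `b` never counts; `V.le` and monotonicity
make the minimum inactive. -/
theorem IsBellmanValue.requestValue_eq_lintegral (hV : IsBellmanValue G μ M Q V)
    (hGm : Monotone G) (hμ : ∀ᵐ y ∂μ, y ∈ Icc BL BU) {r b : ℝ} (hr : BU ≤ r) (hb : 0 ≤ b) :
    requestValue G μ V r b = ∫⁻ y, V (r - y) y ∂μ := by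
  refine lintegral_congr_ae ?_
  filter_upwards [hμ] with y hy
  rw [if_pos (hy.2.trans hr), min_eq_left]
  exact (hV.le _ _).trans (hGm (by linarith))

/-- Waiting until the remaining time is `r` is feasible, and since `a + s ≥ 2 * BU` every
alternative request is covered by `hmin`. -/
theorem IsBellmanValue.eq_border (hV : IsBellmanValue G μ M Q V) (hGm : Monotone G)
    (hBU : 0 < BU) (hμ : ∀ᵐ y ∂μ, y ∈ Icc BL BU) (hM : Q - BU ≤ M) {r : ℝ}
    (hr : r ∈ Icc BU (2 * BU))
    (hmin : ∀ r' ≤ Q, ∀ b ≥ 0, BU ≤ r' ∨ 2 * BU ≤ b + r' →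
      requestValue G μ V r 0 ≤ requestValue G μ V r' b)
    {s a : ℝ} (hs : s ∈ Icc (2 * BU) Q) (ha : 0 ≤ a) : V s a = requestValue G μ V r 0 := by
  rw [hV.eq_iInf s ⟨by linarith [hs.1], hs.2⟩]
  refine le_antisymm ?_ (le_iInf₂ fun z hz => hmin _ (by linarith [hs.2, hz.1]) _
    (by linarith [hz.1]) (Or.inr (by linarith [hs.1])))
  refine (iInf₂_le (s - r) ⟨by linarith [hs.1, hr.2], by linarith [hs.2, hr.1]⟩).trans_eq ?_
  rw [sub_sub_cancel, hV.requestValue_eq_lintegral hGm hμ hr.1 (by linarith [hs.1, hr.2]),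
    hV.requestValue_eq_lintegral hGm hμ hr.1 le_rfl]

/-- A stationary rule that attains the minimum in the optimality equation and that waits until the
remaining time is `r` whenever possible. -/
theorem IsBellmanValue.exists_policy (hV : IsBellmanValue G μ M Q V) (hG : Continuous G)
    (hGm : Monotone G) (hBU : 0 < BU) (hμ : ∀ᵐ y ∂μ, y ∈ Icc BL BU) (hQ : 3 * BU < Q)
    (hM : Q - BU ≤ M) {r : ℝ} (hr : r ∈ Icc BU (2 * BU))
    (hmin : ∀ r' ≤ Q, ∀ b ≥ 0, BU ≤ r' ∨ 2 * BU ≤ b + r' →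
      requestValue G μ V r 0 ≤ requestValue G μ V r' b) :
    ∃ π : StationaryPolicy M, (∀ a, ∀ s ∈ Icc (2 * BU) Q, π.decision a s = s - r) ∧
      ∀ s ∈ Icc 0 Q, ∀ a ≥ 0,
        requestValue G μ V (s - π.decision a s) (a + π.decision a s) = V s a := by
  obtain ⟨z, hz, hzM, hze⟩ := exists_measurable_argmin (X := ℝ × ℝ)
    (f := fun p z => requestValue G μ V (p.2 - z) (p.1 + z))
    (lowerSemicontinuous_requestValue_wait hG hV.lowerSemicontinuous)
    (by linarith : 0 ≤ M)
  refine ⟨⟨fun a s => if s ∈ Icc (2 * BU) Q then s - r else z (a, s), ?_, fun a s => ?_⟩,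
    fun a s hs => if_pos hs, fun s hs a ha => ?_⟩
  · refine Measurable.ite ?_ (by fun_prop) hz
    exact measurableSet_Icc.preimage measurable_snd
  · split_ifs with h
    · exact ⟨by linarith [h.1, hr.2], by linarith [h.2, hr.1]⟩
    · exact hzM _
  · dsimp only
    split_ifs with h
    · rw [hV.eq_border hGm hBU hμ hM hr hmin h ha, sub_sub_cancel,
        hV.requestValue_eq_lintegral hGm hμ hr.1 (by linarith [h.1, hr.2]),
        hV.requestValue_eq_lintegral hGm hμ hr.1 le_rfl]
    · rw [hV.eq_iInf s hs]
      exact hze (a, s)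

variable [IsProbabilityMeasure μ]

theorem requestValue_of_neg (hBL : 0 < BL) (hμ : ∀ᵐ y ∂μ, y ∈ Icc BL BU) {r b : ℝ}
    (hr : r < 0) : requestValue G μ V r b = G (b + r) := by
  rw [requestValue, lintegral_congr_ae (g := fun _ => G (b + r))]
  · simp
  · filter_upwards [hμ] with y hy
    rw [if_neg (by linarith [hy.1])]

/-- A late request is no better than a preliminary request `2 * BU` before the query. -/
theorem IsBellmanValue.requestValue_two_mul_le (hV : IsBellmanValue G μ M Q V)
    (hGm : Monotone G) (hBL : 0 < BL) (hBU : 0 < BU) (hμ : ∀ᵐ y ∂μ, y ∈ Icc BL BU)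
    (hQ : 2 * BU ≤ Q) (hM : 2 * BU ≤ M) {r : ℝ} (hr : r < BU) :
    requestValue G μ V (2 * BU) 0 ≤ requestValue G μ V r (2 * BU - r) := by
  rcases lt_or_ge r 0 with h0 | h0
  · rw [requestValue_of_neg hBL hμ h0]
    refine (requestValue_le _ _ _).trans (hGm (by linarith))
  · rw [hV.requestValue_eq_lintegral hGm hμ (by linarith) le_rfl]
    calc ∫⁻ y, V (2 * BU - y) y ∂μ ≤ ∫⁻ _, requestValue G μ V r (2 * BU - r) ∂μ := by
          refine lintegral_mono_ae ?_
          filter_upwards [hμ] with y hy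
          rw [hV.eq_iInf _ ⟨by linarith [hy.2], by linarith [hy.1]⟩]
          refine (iInf₂_le (2 * BU - y - r) ⟨by linarith [hy.2], by linarith [hy.1]⟩).trans_eq ?_
          congr 1 <;> ring
      _ = requestValue G μ V r (2 * BU - r) := by simp

/-- Lower semicontinuity gives a minimizer on `[BU, 2 * BU]`; late requests reduce to its endpoint
`2 * BU`, early ones to later requests. -/
theorem IsBellmanValue.exists_border (hV : IsBellmanValue G μ M Q V) (hG : Continuous G)
    (hGm : Monotone G) (hBL : 0 < BL) (hBU : 0 < BU) (hμ : ∀ᵐ y ∂μ, y ∈ Icc BL BU)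
    (hQ : 2 * BU ≤ Q) (hM : 2 * BU ≤ M) :
    ∃ r ∈ Icc BU (2 * BU), ∀ r' ≤ Q, ∀ b ≥ 0, BU ≤ r' ∨ 2 * BU ≤ b + r' →
      requestValue G μ V r 0 ≤ requestValue G μ V r' b := by
  have hlsc : LowerSemicontinuous fun r => requestValue G μ V r 0 :=
    (lowerSemicontinuous_requestValue (μ := μ) hG hV.lowerSemicontinuous).comp
      (by fun_prop : Continuous fun r : ℝ => (r, (0 : ℝ)))
  obtain ⟨r, hr, hmin⟩ := (hlsc.lowerSemicontinuousOn (Icc BU (2 * BU))).exists_isMinOn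
    (nonempty_Icc.2 (by linarith)) isCompact_Icc
  have late : ∀ r' < BU, ∀ b, 2 * BU ≤ b + r' →
      requestValue G μ V r 0 ≤ requestValue G μ V r' b := fun r' hr' b hb =>
    (hmin ⟨by linarith, le_rfl⟩).trans
      ((hV.requestValue_two_mul_le hGm hBL hBU hμ hQ hM hr').trans
        (requestValue_mono hGm V r' (by linarith)))
  have early : ∀ r', BU ≤ r' → r' ≤ Q → ∀ b ≥ 0,
      requestValue G μ V r 0 ≤ requestValue G μ V r' b := by
    intro r' h1 h2
    -- Induction on the excess over `2 * BU` in units of `BL`, since each delay removes at least one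
    -- unit.
    obtain ⟨n, hn⟩ := exists_nat_gt ((r' - 2 * BU) / BL)
    rw [div_lt_iff₀ hBL] at hn
    induction n generalizing r' with
    | zero =>
      intro b hb
      simp at hn
      rw [hV.requestValue_eq_lintegral hGm hμ h1 hb,
        ← hV.requestValue_eq_lintegral hGm hμ h1 le_rfl]
      exact hmin ⟨h1, by linarith⟩
    | succ n ih =>
      intro b hb
      push_cast at hn
      rcases le_or_gt r' (2 * BU) with h3 | h3
      · rw [hV.requestValue_eq_lintegral hGm hμ h1 hb,
          ← hV.requestValue_eq_lintegral hGm hμ h1 le_rfl]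
        exact hmin ⟨h1, h3⟩
      · rw [hV.requestValue_eq_lintegral hGm hμ h1 hb]
        calc requestValue G μ V r 0 = ∫⁻ _, requestValue G μ V r 0 ∂μ := by simp
          _ ≤ ∫⁻ y, V (r' - y) y ∂μ := by
            refine lintegral_mono_ae ?_
            filter_upwards [hμ] with y hy
            rw [hV.eq_iInf _ ⟨by linarith [hy.2], by linarith [hy.1]⟩]
            refine le_iInf₂ fun z hz => ?_
            -- The next request is either still safe, where induction applies, or late. Age plus
            -- remaining time is then `r' > 2 * BU`, as `late` requires.
            rcases le_or_gt BU (r' - y - z) with h4 | h4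
            · exact ih _ h4 (by linarith [hy.1, hz.1]) (by linarith [hy.1, hz.1]) _
                (by linarith [hy.1, hz.1])
            · exact late _ h4 _ (by linarith)
  refine ⟨r, hr, fun r' hr' b hb h => ?_⟩
  rcases le_or_gt BU r' with h1 | h1
  · exact early r' h1 hr' b hb
  · exact late r' h1 b (h.resolve_left (not_le.2 h1))

/-- The update arrives after the query on `Ioi r`, which has positive mass, and there the penalties
differ strictly. -/
theorem requestValue_lt_requestValue (hV : LowerSemicontinuous fun p : ℝ × ℝ => V p.1 p.2)
    (hGtop : ∀ x, G x ≠ ∞) (hpos : ∀ x < BU, 0 < μ (Ioi x)) {r b b' : ℝ}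
    (hr : r < BU) (hlt : G (b + r) < G (b' + r)) :
    requestValue G μ V r b < requestValue G μ V r b' := by
  refine lintegral_strict_mono_of_ae_le_of_ae_lt_on (s := Ioi r)
    (measurable_requestValue_integrand hV _ _).aemeasurable
    ((requestValue_le V r b).trans_lt (hGtop _).lt_top).ne (ae_of_all _ fun y => ?_)
    (hpos r hr).ne' (ae_of_all _ fun y hy => ?_)
  · dsimp only
    split_ifs
    · exact min_le_min le_rfl hlt.le
    · exact hlt.le
  · rw [if_neg (not_le.2 hy), if_neg (not_le.2 hy)]
    exact hlt

end Border

/-! ### Real-valued costs -/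

/-- The penalty as an extended nonnegative function on the line. -/
def penalty (g : ℝ → ℝ) (x : ℝ) : ℝ≥0∞ := ENNReal.ofReal (g (max x 0))

section Penalty

variable {g : ℝ → ℝ}

theorem continuous_max_zero (hg : ContinuousOn g (Ici 0)) : Continuous fun x => g (max x 0) :=
  hg.comp_continuous (by fun_prop) fun _ => mem_Ici.2 (le_max_right _ _)

theorem continuous_penalty (hg : ContinuousOn g (Ici 0)) : Continuous (penalty g) :=
  ENNReal.continuous_ofReal.comp (continuous_max_zero hg)

theorem monotone_penalty (hg : MonotoneOn g (Ici 0)) : Monotone (penalty g) := fun _ _ h =>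
  ENNReal.ofReal_le_ofReal (hg (mem_Ici.2 (le_max_right _ _)) (mem_Ici.2 (le_max_right _ _))
    (max_le_max_right 0 h))

theorem penalty_ne_top (x : ℝ) : penalty g x ≠ ∞ := ENNReal.ofReal_ne_top

theorem penalty_lt_penalty (hg : StrictMonoOn g (Ici 0)) (h0 : ∀ x ∈ Ici (0 : ℝ), 0 ≤ g x)
    {x x' : ℝ} (hx : 0 ≤ x) (h : x < x') : penalty g x < penalty g x' := by
  rw [penalty, penalty, max_eq_left hx, max_eq_left (hx.trans h.le)]
  have := hg hx (hx.trans h.le) h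
  exact (ENNReal.ofReal_lt_ofReal_iff ((h0 x hx).trans_lt this)).2 this

theorem integral_penalty {Ω : Type*} [MeasurableSpace Ω] {ν : Measure Ω}
    (hg : ContinuousOn g (Ici 0)) (h0 : ∀ x ∈ Ici (0 : ℝ), 0 ≤ g x) {A : Ω → ℝ}
    (hA : Measurable A) (hA0 : ∀ᵐ x ∂ν, 0 ≤ A x) :
    ∫ x, g (A x) ∂ν = (∫⁻ x, penalty g (A x) ∂ν).toReal := by
  have : ∫ x, g (A x) ∂ν = ∫ x, g (max (A x) 0) ∂ν := by
    refine integral_congr_ae ?_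
    filter_upwards [hA0] with x hx
    rw [max_eq_left hx]
  rw [this, integral_eq_lintegral_of_nonneg_ae
    (ae_of_all _ fun x => h0 _ (mem_Ici.2 (le_max_right _ _)))
    ((continuous_max_zero hg).measurable.comp hA).aestronglyMeasurable]
  rfl

variable {μ : Measure ℝ} [IsProbabilityMeasure μ] {M BL BU : ℝ}

theorem CausalPolicy.measurable_age_path (π : CausalPolicy M) {s : ℝ} (hs : 0 ≤ s) :
    Measurable fun p : π.Seed × (ℕ → ℝ) => age p.2 (fun j => π.wait j p.1 p.2) s :=
  measurable_age measurable_snd π.measurable_wait hs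

theorem queryCost_eq (hg : ContinuousOn g (Ici 0)) (h0 : ∀ x ∈ Ici (0 : ℝ), 0 ≤ g x)
    (hBL : 0 < BL) (hμ : ∀ᵐ y ∂μ, y ∈ Icc BL BU) (π : CausalPolicy M) {s : ℝ} (hs : 0 ≤ s) :
    queryCost g μ s π = (∫⁻ ξ, ∫⁻ a, waitCost (penalty g) μ (fun j => π.wait j ξ) s a ∂μ
      ∂π.seedLaw).toReal := by
  have hA := π.measurable_age_path hs
  have hF := (continuous_penalty hg).measurable.comp hA
  rw [queryCost, integral_penalty hg h0 hA]
  · congr 1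
    refine (lintegral_prod _ hF.aemeasurable).trans (lintegral_congr fun ξ => ?_)
    exact lintegral_infinitePi_cons μ (hF.comp measurable_prodMk_left)
  · have := Measure.quasiMeasurePreserving_snd (μ := π.seedLaw) |>.ae (ae_infinitePi_mem μ hμ)
    filter_upwards [this] with p hp
    exact age_nonneg (fun j => hBL.le.trans (hp j).1) hs

theorem costFrom_eq (hg : ContinuousOn g (Ici 0)) (h0 : ∀ x ∈ Ici (0 : ℝ), 0 ≤ g x)
    (hBL : 0 < BL) (hμ : ∀ᵐ y ∂μ, y ∈ Icc BL BU) (π : CausalPolicy M) {s a : ℝ} (hs : 0 ≤ s)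
    (ha : 0 ≤ a) :
    costFrom g μ s a π = (∫⁻ ξ, waitCost (penalty g) μ (fun j => π.wait j ξ) s a
      ∂π.seedLaw).toReal := by
  have hup : Measurable fun p : π.Seed × (ℕ → ℝ) => (p.1, Function.update p.2 0 a) :=
    measurable_fst.prodMk
      ((by fun_prop : Measurable fun y : ℕ → ℝ => Function.update y 0 a).comp measurable_snd)
  have hA := (π.measurable_age_path hs).comp hup
  have hG := (continuous_penalty hg).measurable
  have hF := hG.comp hA
  refine (integral_penalty hg h0 hA ?_).trans ?_
  · have := Measure.quasiMeasurePreserving_snd (μ := π.seedLaw) |>.ae (ae_infinitePi_mem μ hμ)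
    filter_upwards [this] with p hp
    refine age_nonneg (fun j => ?_) hs
    cases j with
    | zero => simpa using ha
    | succ j => simpa using hBL.le.trans (hp (j + 1)).1
  · congr 1
    refine (lintegral_prod _ hF.aemeasurable).trans (lintegral_congr fun ξ => ?_)
    exact lintegral_infinitePi_update μ
      (hG.comp ((π.measurable_age_path hs).comp measurable_prodMk_left)) a

theorem costFrom_feedbackPolicy (hg : ContinuousOn g (Ici 0))
    (h0 : ∀ x ∈ Ici (0 : ℝ), 0 ≤ g x) (hBL : 0 < BL) (hμ : ∀ᵐ y ∂μ, y ∈ Icc BL BU)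
    {q : ℕ → ℝ → ℝ → ℝ} (hq : ∀ j, Measurable fun p : ℝ × ℝ => q j p.1 p.2)
    (hM : ∀ j a r, q j a r ∈ Icc 0 M) {s a : ℝ} (hs : 0 ≤ s) (ha : 0 ≤ a) :
    costFrom g μ s a (feedbackPolicy q hq hM s)
      = (waitCost (penalty g) μ (feedbackRule q s) s a).toReal := by
  rw [costFrom_eq hg h0 hBL hμ _ hs ha]
  congr 1
  exact lintegral_dirac (α := Unit) () _

theorem IsBellmanValue.toReal_le_costFrom {V : ℝ → ℝ → ℝ≥0∞} {Q : ℝ}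
    (hV : IsBellmanValue (penalty g) μ M Q V) (hg : ContinuousOn g (Ici 0))
    (hgm : MonotoneOn g (Ici 0)) (h0 : ∀ x ∈ Ici (0 : ℝ), 0 ≤ g x) (hBL : 0 < BL)
    (hμ : ∀ᵐ y ∂μ, y ∈ Icc BL BU) (π : CausalPolicy M) {s a : ℝ} (hs : s ∈ Icc 0 Q)
    (ha : 0 ≤ a) : (V s a).toReal ≤ costFrom g μ s a π := by
  have hGm := monotone_penalty hgm
  rw [costFrom_eq hg h0 hBL hμ π hs.1 ha]
  refine ENNReal.toReal_mono ?_ ?_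
  · refine ne_top_of_le_ne_top (penalty_ne_top (g := g) (a + s)) ?_
    calc _ ≤ ∫⁻ _, penalty g (a + s) ∂π.seedLaw :=
          lintegral_mono fun ξ => waitCost_le hGm hBL hμ hs.1 ha
      _ = _ := by simp
  · calc V s a = ∫⁻ _, V s a ∂π.seedLaw := by simp
      _ ≤ _ := lintegral_mono fun ξ =>
        hV.le_waitCost (continuous_penalty hg).measurable hBL hμ (π.isWaitRule ξ) hs ha

end Penalty

/-! ### Optimal stationary policies -/

section Optimal

variable {g : ℝ → ℝ} {μ : Measure ℝ} [IsProbabilityMeasure μ] {M Q BL BU : ℝ}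
  {V : ℝ → ℝ → ℝ≥0∞}

theorem GD_eq (hg : ContinuousOn g (Ici 0)) (h0 : ∀ x ∈ Ici (0 : ℝ), 0 ≤ g x)
    (hBL : 0 < BL) (hμ : ∀ᵐ y ∂μ, y ∈ Icc BL BU) (π : StationaryPolicy M) {s a : ℝ} (hs : 0 ≤ s)
    (ha : 0 ≤ a) : GD g μ π s a
      = (waitCost (penalty g) μ (feedbackRule (fun _ => π.decision) s) s a).toReal :=
  costFrom_feedbackPolicy hg h0 hBL hμ _ _ hs ha

/-- `π` attains the value `V` after every delivery. -/
def AttainsValue (g : ℝ → ℝ) (μ : Measure ℝ) [IsProbabilityMeasure μ] (BL BU Q : ℝ)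
    (V : ℝ → ℝ → ℝ≥0∞) (π : StationaryPolicy M) : Prop :=
  ∀ s ∈ Icc 0 Q, ∀ a ∈ Icc BL BU,
    waitCost (penalty g) μ (feedbackRule (fun _ => π.decision) s) s a = V s a

theorem AttainsValue.isOptimalAtDeliveries {π : StationaryPolicy M}
    (hπ : AttainsValue g μ BL BU Q V π) (hV : IsBellmanValue (penalty g) μ M Q V)
    (hg : ContinuousOn g (Ici 0)) (hgm : MonotoneOn g (Ici 0))
    (h0 : ∀ x ∈ Ici (0 : ℝ), 0 ≤ g x) (hBL : 0 < BL) (hμ : ∀ᵐ y ∂μ, y ∈ Icc BL BU) :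
    IsOptimalAtDeliveries g μ BL BU Q π := by
  intro D hD a ha π'
  have hs : Q - D ∈ Icc 0 Q := ⟨by linarith [hD.2], by linarith [hD.1]⟩
  have ha0 : 0 ≤ a := hBL.le.trans ha.1
  rw [GD_eq hg h0 hBL hμ π hs.1 ha0, hπ _ hs a ha]
  exact hV.toReal_le_costFrom hg hgm h0 hBL hμ π' hs ha0

theorem AttainsValue.isQueryOptimal {π : StationaryPolicy M}
    (hπ : AttainsValue g μ BL BU Q V π) (hV : IsBellmanValue (penalty g) μ M Q V)
    (hg : ContinuousOn g (Ici 0)) (hgm : MonotoneOn g (Ici 0))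
    (h0 : ∀ x ∈ Ici (0 : ℝ), 0 ≤ g x) (hBL : 0 < BL) (hμ : ∀ᵐ y ∂μ, y ∈ Icc BL BU)
    (hQ : 0 ≤ Q) : IsQueryOptimal g μ Q π := by
  intro π'
  have hs : Q ∈ Icc 0 Q := ⟨hQ, le_rfl⟩
  have hGm := monotone_penalty hgm
  have hl : queryCost g μ Q (π.toCausal Q) = (∫⁻ a, V Q a ∂μ).toReal := by
    rw [queryCost_eq hg h0 hBL hμ _ hQ]
    congr 1
    refine (lintegral_dirac (α := Unit) () _).trans (lintegral_congr_ae ?_)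
    filter_upwards [hμ] with a ha
    exact hπ Q hs a ha
  rw [hl, queryCost_eq hg h0 hBL hμ _ hQ]
  refine ENNReal.toReal_mono ?_ ?_
  · refine ne_top_of_le_ne_top (penalty_ne_top (g := g) (BU + Q)) ?_
    calc _ ≤ ∫⁻ _, ∫⁻ _, penalty g (BU + Q) ∂μ ∂π'.seedLaw := by
          refine lintegral_mono fun ξ => lintegral_mono_ae ?_
          filter_upwards [hμ] with a ha
          exact (waitCost_le hGm hBL hμ hQ (hBL.le.trans ha.1)).trans
            (hGm (by linarith [ha.2]))
      _ = _ := by simp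
  · calc ∫⁻ a, V Q a ∂μ = ∫⁻ _, ∫⁻ a, V Q a ∂μ ∂π'.seedLaw := by simp
      _ ≤ _ := by
        refine lintegral_mono fun ξ => lintegral_mono_ae ?_
        filter_upwards [hμ] with a ha
        exact hV.le_waitCost (continuous_penalty hg).measurable hBL hμ (π'.isWaitRule ξ) hs
          (hBL.le.trans ha.1)

/-- Comparison with `π₀`, which attains `V`, at every state; both costs are finite, so the real
inequality lifts to `ℝ≥0∞`. -/
theorem IsOptimalAtDeliveries.attainsValue {π π₀ : StationaryPolicy M}
    (hπ : IsOptimalAtDeliveries g μ BL BU Q π) (hπ₀ : AttainsValue g μ BL BU Q V π₀)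
    (hV : IsBellmanValue (penalty g) μ M Q V)
    (hg : ContinuousOn g (Ici 0)) (hgm : MonotoneOn g (Ici 0))
    (h0 : ∀ x ∈ Ici (0 : ℝ), 0 ≤ g x) (hBL : 0 < BL) (hμ : ∀ᵐ y ∂μ, y ∈ Icc BL BU) :
    AttainsValue g μ BL BU Q V π := by
  intro s hs a ha
  have ha0 : 0 ≤ a := hBL.le.trans ha.1
  have hw := isWaitRule_feedbackRule (q := fun _ => π.decision)
    (fun _ => π.measurable_decision) (fun _ => π.decision_mem) s
  refine le_antisymm ?_ (hV.le_waitCost (continuous_penalty hg).measurable hBL hμ hw hs ha0)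
  have h := hπ (Q - s) ⟨by linarith [hs.2], by linarith [hs.1]⟩ a ha (π₀.toCausal s)
  rw [sub_sub_cancel] at h
  change _ ≤ GD g μ π₀ s a at h
  rw [GD_eq hg h0 hBL hμ π hs.1 ha0, GD_eq hg h0 hBL hμ π₀ hs.1 ha0, hπ₀ s hs a ha] at h
  refine (ENNReal.toReal_le_toReal ?_ ?_).1 h
  · exact ne_top_of_le_ne_top (penalty_ne_top _)
      (waitCost_le (monotone_penalty hgm) hBL hμ hs.1 ha0)
  · exact ne_top_of_le_ne_top (penalty_ne_top _) (hV.le s a)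

theorem AttainsValue.requestValue_decision {π : StationaryPolicy M}
    (hπ : AttainsValue g μ BL BU Q V π) (hV : IsBellmanValue (penalty g) μ M Q V)
    (hg : ContinuousOn g (Ici 0)) (hgm : MonotoneOn g (Ici 0)) (hBL : 0 < BL)
    (hμ : ∀ᵐ y ∂μ, y ∈ Icc BL BU) {s a : ℝ} (hs : s ∈ Icc 0 Q) (ha : a ∈ Icc BL BU) :
    requestValue (penalty g) μ V (s - π.decision a s) (a + π.decision a s) = V s a := by
  rw [← hπ s hs a ha]
  exact (hV.waitCost_feedbackRule_eq (q := fun _ => π.decision)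
    (continuous_penalty hg).measurable (monotone_penalty hgm) hBL hμ
    (fun _ => π.measurable_decision) (fun _ => π.decision_mem) hs (hBL.le.trans ha.1) hπ).symm

theorem AttainsValue.GR_eq {π : StationaryPolicy M}
    (hπ : AttainsValue g μ BL BU Q V π) (hV : IsBellmanValue (penalty g) μ M Q V)
    (hg : ContinuousOn g (Ici 0)) (hgm : MonotoneOn g (Ici 0))
    (h0 : ∀ x ∈ Ici (0 : ℝ), 0 ≤ g x) (hBL : 0 < BL) (hμ : ∀ᵐ y ∂μ, y ∈ Icc BL BU)
    {r b : ℝ} (hr : r ∈ Icc 0 Q) (hb : 0 ≤ b) :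
    GR g μ π r b = (requestValue (penalty g) μ V r b).toReal := by
  set q : ℕ → ℝ → ℝ → ℝ := fun j a r => if j = 0 then 0 else π.decision a r with hqdef
  have hq : ∀ j, Measurable fun p : ℝ × ℝ => q j p.1 p.2 := fun j =>
    Measurable.ite (MeasurableSet.const _) measurable_const π.measurable_decision
  have hM : ∀ j a r, q j a r ∈ Icc 0 M := fun j a r => by
    simp only [hqdef]
    split_ifs
    · exact ⟨le_rfl, (π.decision_mem 0 0).1.trans (π.decision_mem 0 0).2⟩
    · exact π.decision_mem a r
  refine (costFrom_feedbackPolicy hg h0 hBL hμ hq hM hr.1 hb).trans ?_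
  rw [hV.waitCost_feedbackRule_eq (continuous_penalty hg).measurable (monotone_penalty hgm) hBL hμ
    hq hM hr hb ?_]
  · simp [hqdef]
  · intro s hs x hx
    simpa [hqdef] using hπ s hs x hx

theorem AttainsValue.isBorderPoint {π : StationaryPolicy M}
    (hπ : AttainsValue g μ BL BU Q V π) (hV : IsBellmanValue (penalty g) μ M Q V)
    (hg : ContinuousOn g (Ici 0)) (hgm : MonotoneOn g (Ici 0))
    (h0 : ∀ x ∈ Ici (0 : ℝ), 0 ≤ g x) (hBL : 0 < BL) (hBU : BL ≤ BU)
    (hμ : ∀ᵐ y ∂μ, y ∈ Icc BL BU) (hQ : 3 * BU < Q) (hM : Q - BU ≤ M) {r : ℝ}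
    (hr : r ∈ Icc BU (2 * BU))
    (hmin : ∀ r' ≤ Q, ∀ b ≥ 0, BU ≤ r' ∨ 2 * BU ≤ b + r' →
      requestValue (penalty g) μ V r 0 ≤ requestValue (penalty g) μ V r' b)
    (hsel : selectedPoint BL BU Q π ≤ Q - BU) :
    IsBorderPoint g μ BU Q π (selectedPoint BL BU Q π) ∧
      ∀ D ∈ Ico 0 (Q - 3 * BU), ∀ a ∈ Icc BL BU,
        IsOptimalRequest g μ Q π D a (selectedPoint BL BU Q π) := by
  have hGm := monotone_penalty hgm
  have hz := π.decision_mem BL (3 * BU)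
  have h3 : 3 * BU ∈ Icc 0 Q := ⟨by linarith, hQ.le⟩
  have hreq := hπ.requestValue_decision hV hg hgm hBL hμ h3 ⟨le_rfl, hBU⟩
  rw [hV.eq_border hGm (hBL.trans_le hBU) hμ hM hr hmin ⟨by linarith, hQ.le⟩ hBL.le] at hreq
  have hP : Q - selectedPoint BL BU Q π = 3 * BU - π.decision BL (3 * BU) := by
    rw [selectedPoint]; ring
  have hP1 : BU ≤ Q - selectedPoint BL BU Q π := by linarith
  have hPQ : Q - selectedPoint BL BU Q π ∈ Icc 0 Q := ⟨by linarith, by linarith [hz.1]⟩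
  -- By `hreq` the chosen request has the minimal value at its actual age; with at least `BU` time
  -- left that value is the same at every age `b`.
  have hGR : ∀ b ≥ 0, GR g μ π (Q - selectedPoint BL BU Q π) b
      = (requestValue (penalty g) μ V r 0).toReal := by
    intro b hb
    rw [hπ.GR_eq hV hg hgm h0 hBL hμ hPQ hb, ← hreq, ← hP,
      hV.requestValue_eq_lintegral hGm hμ hP1 hb,
      hV.requestValue_eq_lintegral hGm hμ hP1 (by linarith [hz.1])]
  refine ⟨⟨⟨by linarith [hPQ.2, hz.1], hsel⟩, fun R hR b hb b' hb' => ?_⟩, fun D hD a ha =>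
    ⟨⟨by linarith [hD.2, hz.1], by linarith [hD.1]⟩, fun π' => ?_⟩⟩
  · have hRQ : Q - R ∈ Icc 0 Q := ⟨by linarith [hR.2], by linarith [hR.1]⟩
    rw [hGR b hb, hπ.GR_eq hV hg hgm h0 hBL hμ hRQ hb']
    exact ENNReal.toReal_mono (ne_top_of_le_ne_top (penalty_ne_top _) (requestValue_le _ _ _))
      (hmin _ hRQ.2 _ hb' (Or.inl (by linarith [hR.2])))
  · have hDQ : Q - D ∈ Icc (2 * BU) Q := ⟨by linarith [hD.2], by linarith [hD.1]⟩
    have ha0 : 0 ≤ a := hBL.le.trans ha.1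
    rw [hGR _ (by linarith [hD.2, hz.1]),
      ← hV.eq_border hGm (hBL.trans_le hBU) hμ hM hr hmin hDQ ha0]
    exact hV.toReal_le_costFrom hg hgm h0 hBL hμ π' ⟨by linarith [hDQ.1], hDQ.2⟩ ha0

theorem AttainsValue.selectedPoint_le {π : StationaryPolicy M}
    (hπ : AttainsValue g μ BL BU Q V π) (hV : IsBellmanValue (penalty g) μ M Q V)
    (hg : ContinuousOn g (Ici 0)) (hgm : StrictMonoOn g (Ici 0))
    (h0 : ∀ x ∈ Ici (0 : ℝ), 0 ≤ g x) (hBL : 0 < BL) (hBU : BL ≤ BU)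
    (hμ : ∀ᵐ y ∂μ, y ∈ Icc BL BU) (hpos : ∀ x < BU, 0 < μ (Ioi x)) (hQ : 3 * BU < Q)
    (hM : Q - BU ≤ M) {r : ℝ} (hr : r ∈ Icc BU (2 * BU))
    (hmin : ∀ r' ≤ Q, ∀ b ≥ 0, BU ≤ r' ∨ 2 * BU ≤ b + r' →
      requestValue (penalty g) μ V r 0 ≤ requestValue (penalty g) μ V r' b) :
    selectedPoint BL BU Q π ≤ Q - BU := by
  by_contra! hsel
  have hGm := monotone_penalty hgm.monotoneOn
  have hz := π.decision_mem BL (3 * BU)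
  have h3 : 3 * BU ∈ Icc 0 Q := ⟨by linarith, hQ.le⟩
  have hreq := hπ.requestValue_decision hV hg hgm.monotoneOn hBL hμ h3 ⟨le_rfl, hBU⟩
  rw [hV.eq_border hGm (hBL.trans_le hBU) hμ hM hr hmin ⟨by linarith, hQ.le⟩ hBL.le] at hreq
  rw [selectedPoint] at hsel
  set z := π.decision BL (3 * BU)
  -- The same late request is compared at the smaller age that makes the total exactly `2 * BU`, the
  -- smallest to which `hmin` applies; the actual total is `BL + 3 * BU`.
  have hlt : requestValue (penalty g) μ V (3 * BU - z) (2 * BU - (3 * BU - z))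
      < requestValue (penalty g) μ V (3 * BU - z) (BL + z) := by
    refine requestValue_lt_requestValue hV.lowerSemicontinuous penalty_ne_top hpos
      (by linarith) (penalty_lt_penalty hgm h0 (by linarith) (by linarith))
  refine (hmin (3 * BU - z) (by linarith [hz.1]) (2 * BU - (3 * BU - z)) (by linarith)
    (Or.inr (by linarith))).not_gt ?_
  rwa [hreq] at hlt

end Optimal

end PullOrWait

end

/-! ### Assembly of the three claims -/

theorem corollary2
    (g : ℝ → ℝ) (hg_cont : ContinuousOn g (Set.Ici 0)) (hg_mono : MonotoneOn g (Set.Ici 0))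
    (hg_nonneg : ∀ x ∈ Set.Ici (0 : ℝ), 0 ≤ g x)
    (μ : MeasureTheory.Measure ℝ) [MeasureTheory.IsProbabilityMeasure μ]
    (BL BU M Q : ℝ) (hBL : 0 < BL) (hμ : μ (Set.Icc BL BU) = 1)
    (hQ : 3 * BU < Q) (hM : Q - BU ≤ M) :
    -- existence of a deterministic optimal policy whose first request is its border point
    (∃ π : PullOrWait.StationaryPolicy M,
      PullOrWait.IsQueryOptimal g μ Q π ∧
      PullOrWait.IsOptimalAtDeliveries g μ BL BU Q π ∧
      PullOrWait.selectedPoint BL BU Q π ∈ Set.Icc (Q - 3 * BU) (Q - BU) ∧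
      PullOrWait.IsBorderPoint g μ BU Q π (PullOrWait.selectedPoint BL BU Q π) ∧
      (∀ y : ℕ → ℝ, y 0 ∈ Set.Icc BL BU → ∀ ξ,
        PullOrWait.requestTime y (fun j => (π.toCausal Q).wait j ξ y) 1
          = PullOrWait.selectedPoint BL BU Q π) ∧
      (∀ D ∈ Set.Ico 0 (Q - 3 * BU), ∀ a ∈ Set.Icc BL BU,
        D + π.decision a (Q - D) = PullOrWait.selectedPoint BL BU Q π ∧
        PullOrWait.IsOptimalRequest g μ Q π D a (PullOrWait.selectedPoint BL BU Q π))) ∧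
    -- every deterministic optimal policy whose selected point is at most `Q - BU`
    (∀ π : PullOrWait.StationaryPolicy M,
      PullOrWait.IsOptimalAtDeliveries g μ BL BU Q π →
      PullOrWait.selectedPoint BL BU Q π ≤ Q - BU →
      PullOrWait.IsBorderPoint g μ BU Q π (PullOrWait.selectedPoint BL BU Q π) ∧
      ∀ D ∈ Set.Ico 0 (Q - 3 * BU), ∀ a ∈ Set.Icc BL BU,
        PullOrWait.IsOptimalRequest g μ Q π D a (PullOrWait.selectedPoint BL BU Q π)) ∧
    -- in the nondegenerate case the selected point is always in `[Q - 3 BU, Q - BU]`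
    (StrictMonoOn g (Set.Ici 0) → (∀ x < BU, 0 < μ (Set.Ioi x)) →
      ∀ π : PullOrWait.StationaryPolicy M,
        PullOrWait.IsOptimalAtDeliveries g μ BL BU Q π →
        PullOrWait.selectedPoint BL BU Q π ∈ Set.Icc (Q - 3 * BU) (Q - BU)) := by
  have hae : ∀ᵐ y ∂μ, y ∈ Set.Icc BL BU := (mem_ae_iff_prob_eq_one measurableSet_Icc).2 hμ
  have hBU : BL ≤ BU := by
    by_contra! h
    simp [Set.Icc_eq_empty (not_le.2 h)] at hμ
  have hBU0 : 0 < BU := hBL.trans_le hBU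
  have hG := PullOrWait.continuous_penalty hg_cont
  have hGm := PullOrWait.monotone_penalty hg_mono
  obtain ⟨V, hV⟩ := PullOrWait.exists_isBellmanValue hG (by linarith : 0 ≤ M) hBL hae Q
  obtain ⟨r, hr, hmin⟩ := hV.exists_border hG hGm hBL hBU0 hae (by linarith) (by linarith)
  obtain ⟨π₀, hwait, hπ₀⟩ := hV.exists_policy hG hGm hBU0 hae hQ hM hr hmin
  have hatt : PullOrWait.AttainsValue g μ BL BU Q V π₀ := fun s hs a ha =>
    hV.waitCost_stationary hG.measurable hGm hBL hae π₀
      (fun s hs a ha => hπ₀ s hs a (hBL.le.trans ha.1)) hs ha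
  have hall : ∀ π : PullOrWait.StationaryPolicy M,
      PullOrWait.IsOptimalAtDeliveries g μ BL BU Q π → PullOrWait.AttainsValue g μ BL BU Q V π :=
    fun π hπ => hπ.attainsValue hatt hV hg_cont hg_mono hg_nonneg hBL hae
  have hge : ∀ π : PullOrWait.StationaryPolicy M,
      Q - 3 * BU ≤ PullOrWait.selectedPoint BL BU Q π := fun π => by
    have := (π.decision_mem BL (3 * BU)).1
    rw [PullOrWait.selectedPoint]; linarith
  refine ⟨?_, fun π hπ hsel => (hall π hπ).isBorderPoint hV hg_cont hg_mono hg_nonneg hBL hBU hae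
    hQ hM hr hmin hsel, fun hgs hpos π hπ => ⟨hge π, (hall π hπ).selectedPoint_le hV hg_cont hgs
    hg_nonneg hBL hBU hae hpos hQ hM hr hmin⟩⟩
  -- The selected point is the instant with remaining time `r`, which `π₀` targets whenever at least
  -- `2 * BU` is left, in particular from time 0.
  have hsel : PullOrWait.selectedPoint BL BU Q π₀ = Q - r := by
    rw [PullOrWait.selectedPoint, hwait BL (3 * BU) ⟨by linarith, hQ.le⟩]; ring
  have hle : PullOrWait.selectedPoint BL BU Q π₀ ≤ Q - BU := by
    rw [hsel]; linarith [hr.1]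
  obtain ⟨hborder, hreq⟩ := hatt.isBorderPoint hV hg_cont hg_mono hg_nonneg hBL hBU hae
    hQ hM hr hmin hle
  refine ⟨π₀, hatt.isQueryOptimal hV hg_cont hg_mono hg_nonneg hBL hae (by linarith),
    hatt.isOptimalAtDeliveries hV hg_cont hg_mono hg_nonneg hBL hae, ⟨hge π₀, hle⟩, hborder,
    fun y hy ξ => ?_, fun D hD a ha => ⟨?_, hreq D hD a ha⟩⟩
  · change 0 + π₀.decision (y 0) (Q - 0) = _
    rw [sub_zero, hwait _ _ ⟨by linarith, le_rfl⟩, hsel, zero_add]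
  · rw [hwait _ _ ⟨by linarith [hD.2], by linarith [hD.1]⟩, hsel]; ring
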